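/- Let $k$ be a field of characteristic $0$. A representation of a Lie algebra over $k$ is regarded as a two-sorted algebra $H=(H^{(1)},H^{(2)})$, where $H^{(1)}$ is a Lie algebra over $k$ and $H^{(2)}$ is a vector space over $k$ on which it acts; the operations are $0^{(i)}$, $-^{(i)}$, $\lambda^{(i)}$ ($\lambda\in k$), $+^{(i)}$ for $i=1,2$, the bracket $[\,,]$ on the first sort, and the action $\circ$ (first sort times second sort into second sort). Fix countably infinite disjoint sets of variables $X_0^{(1)},X_0^{(2)}$. Let $\Theta$ be a variety of representations, that is, the class of all representations satisfying some set of identities. For finite $X=X^{(1)}\cup X^{(2)}$, $X^{(i)}\subset X_0^{(i)}$, let $F_\Theta(X)$ be the free representation of $\Theta$ on $X$: its first sort is $L(X^{(1)})/I_\Theta(X^{(1)})$, where $L(X^{(1)})$ is the free Lie algebra and $I_\Theta(X^{(1)})$ is the ideal of all $l$ such that the identity $l=0$ holds in $\Theta$; its second sort is the free left module with basis $X^{(2)}$ over the free associative unital algebra on $X^{(1)}$, modulo the submodule of all $v$ such that the identity $v=0$ holds in $\Theta$. $\Theta$ is called action-type if $I_\Theta(X^{(1)})=\{0\}$ for all finite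 $X^{(1)}\subset X_0^{(1)}$, and degenerated if the identity $[x_1^{(1)},x_2^{(1)}]\circ x^{(2)}=0$ holds in $\Theta$. A system of words $W$ consists of one element $w_\omega\in F_\omega$ for every operation $\omega$ above, where $F_\omega$ is the free representation of $\Theta$ generated by distinct variables, one for every argument of $\omega$ and of the sort of that argument, and $w_\omega$ has the sort of the result of $\omega$. For $H\in\Theta$ let $H_W^*$ be the pair of sets $(H^{(1)},H^{(2)})$ in which every operation $\omega$ is replaced by the verbal operation $(h_1,\dots,h_n)\mapsto\alpha(w_\omega)$, where $\alpha:F_\omega\to H$ is the homomorphism that sends the generators of $F_\omega$ to $h_1,\dots,h_n$. **Proposition.** Let $\Theta$ be an action-type variety of representations that is not degenerated. Let $W$ be a system of words such that for every finite $X$ there is a sort-preserving bijection $s_F:F\to F$ of $F=F_\Theta(X)$ with $s_F|_X=\mathrm{id}_X$ that is an isomorphism $F\to F_W^*$. Then there are $\varphi\in\mathrm{Aut}\,k$ and $a\in k^*$ such that $$w_{0^{(1)}}=0^{(1)},\quad w_{-^{(1)}}=-x^{(1)},\quad w_{\lambda^{(1)}}=\varphi(\lambda)x^{(1)}\ (\lambda\in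 k),\quad w_{+^{(1)}}=x_1^{(1)}+x_2^{(1)},\quad w_{[,]}=a[x_1^{(1)},x_2^{(1)}],$$ $$w_{0^{(2)}}=0^{(2)},\quad w_{-^{(2)}}=-x^{(2)},\quad w_{\lambda^{(2)}}=\varphi(\lambda)x^{(2)}\ (\lambda\in k),\quad w_{+^{(2)}}=x_1^{(2)}+x_2^{(2)},\quad w_{\circ}=a\,(x^{(1)}\circ x^{(2)}).$$ -/

import Mathlib

universe u

namespace LieRepresentation

/-- A representation of a Lie algebra over `k`: a Lie algebra `L`, a vector space `V` and a bilinear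
action `l ∘ v` of `L` on `V` such that `[x, y] ∘ v = x ∘ (y ∘ v) - y ∘ (x ∘ v)`. It is a two-sorted
algebra: `L` is the first sort and `V` is the second sort. -/
structure Rep (k : Type u) [Field k] where
  L : Type u
  V : Type u
  [lieRing : LieRing L]
  [lieAlgebra : LieAlgebra k L]
  [addCommGroup : AddCommGroup V]
  [module : Module k V]
  act : L →ₗ[k] V →ₗ[k] V
  act_lie : ∀ (x y : L) (v : V), act ⁅x, y⁆ v = act x (act y v) - act y (act x v)

attribute [instance] Rep.lieRing Rep.lieAlgebra Rep.addCommGroup Rep.module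

section AbsolutelyFree

attribute [local instance] LieRing.ofAssociativeRing LieAlgebra.ofAssociativeAlgebra

/-- The canonical homomorphism `ι : L(S) → A(S)` of the free Lie algebra into the free associative
algebra with unit, the latter taken with the commutator bracket. -/
noncomputable def iota (k : Type u) [Field k] (S : Type) : FreeLieAlgebra k S →ₗ[k] FreeAlgebra k S :=
  (FreeLieAlgebra.lift k (FreeAlgebra.ι k (X := S)) : FreeLieAlgebra k S →ₗ⁅k⁆ FreeAlgebra k S)

theorem iota_of (k : Type u) [Field k] (S : Type) (s : S) :
    iota k S (FreeLieAlgebra.of k s) = FreeAlgebra.ι k s := by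
  simp [iota]

theorem iota_lie (k : Type u) [Field k] (S : Type) (x y : FreeLieAlgebra k S) :
    iota k S ⁅x, y⁆ = iota k S x * iota k S y - iota k S y * iota k S x := by
  simp [iota, LieRing.of_associative_ring_bracket]

/-- The absolutely free representation generated by `S` (first sort) and `T` (second sort): the first
sort is the free Lie algebra `L(S)`, the second sort is the free left `A(S)`-module with basis `T`,
and `l ∘ v = ι(l) v`. -/
noncomputable def absFree (k : Type u) [Field k] (S T : Type) : Rep k where
  L := FreeLieAlgebra k S
  V := T →₀ FreeAlgebra k S
  act :=
    { toFun := fun l => (Algebra.lsmul k k (T →₀ FreeAlgebra k S)) (iota k S l)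
      map_add' := fun x y => by simp
      map_smul' := fun c x => by simp }
  act_lie := fun x y v => by
    simp [iota_lie]

/-- The first-sort component of the homomorphism from the absolutely free representation to `H` that
sends the generators of the first sort to the values of `f`. -/
noncomputable def evalL {k : Type u} [Field k] {S : Type} (H : Rep k) (f : S → H.L) :
    FreeLieAlgebra k S →ₗ⁅k⁆ H.L :=
  FreeLieAlgebra.lift k f

/-- The second-sort component of the homomorphism from the absolutely free representation to `H` that
sends the generators to the values of `f` and of `g`. -/
noncomputable def evalV {k : Type u} [Field k] {S T : Type} (H : Rep k) (f : S → H.L) (g : T → H.V) :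
    (T →₀ FreeAlgebra k S) →ₗ[k] H.V :=
  Finsupp.lsum k fun t =>
    (LinearMap.applyₗ (g t)).comp
      (FreeAlgebra.lift k (fun s => (H.act (f s) : Module.End k H.V))).toLinearMap

theorem evalL_of {k : Type u} [Field k] {S : Type} (H : Rep k) (f : S → H.L) (s : S) :
    evalL H f (FreeLieAlgebra.of k s) = f s := by
  simp [evalL]

theorem evalV_single {k : Type u} [Field k] {S T : Type} (H : Rep k) (f : S → H.L) (g : T → H.V)
    (t : T) (a : FreeAlgebra k S) :
    evalV H f g (Finsupp.single t a) =
      (FreeAlgebra.lift k (fun s => (H.act (f s) : Module.End k H.V)) a) (g t) := by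
  simp [evalV]

theorem lift_iota {k : Type u} [Field k] {S : Type} (H : Rep k) (f : S → H.L)
    (l : FreeLieAlgebra k S) :
    FreeAlgebra.lift k (fun s => (H.act (f s) : Module.End k H.V)) (iota k S l) =
      H.act (evalL H f l) := by
  let ρ : H.L →ₗ⁅k⁆ Module.End k H.V :=
    { H.act with
      map_lie' := fun {x y} => by
        ext v
        simp [LieRing.of_associative_ring_bracket, H.act_lie] }
  have h : ((FreeAlgebra.lift k (fun s => (H.act (f s) : Module.End k H.V))) :
        FreeAlgebra k S →ₗ⁅k⁆ Module.End k H.V).comp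
        (FreeLieAlgebra.lift k (FreeAlgebra.ι k (X := S))) = ρ.comp (evalL H f) := by
    apply FreeLieAlgebra.hom_ext
    intro s
    simp only [LieHom.comp_apply, evalL, FreeLieAlgebra.lift_of_apply]
    exact FreeAlgebra.lift_ι_apply _ s
  exact LieHom.congr_fun h l

/-- The two components respect the action, so together they form a homomorphism. -/
theorem evalV_act {k : Type u} [Field k] {S T : Type} (H : Rep k) (f : S → H.L) (g : T → H.V)
    (l : FreeLieAlgebra k S) (v : T →₀ FreeAlgebra k S) :
    evalV H f g (iota k S l • v) = H.act (evalL H f l) (evalV H f g v) := by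
  induction v using Finsupp.induction_linear with
  | zero => simp
  | add v w hv hw => rw [smul_add, map_add, map_add, map_add, hv, hw]
  | single t a =>
    rw [Finsupp.smul_single, evalV_single, evalV_single, smul_eq_mul, map_mul, lift_iota]
    rfl

/-- Homomorphisms commute with evaluation. -/
theorem evalL_comp {k : Type u} [Field k] {S : Type} {H H' : Rep k} (a : H.L →ₗ⁅k⁆ H'.L)
    (f : S → H.L) (l : FreeLieAlgebra k S) :
    evalL H' (fun s => a (f s)) l = a (evalL H f l) := by
  have h : evalL H' (fun s => a (f s)) = a.comp (evalL H f) := by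
    apply FreeLieAlgebra.hom_ext
    intro s
    simp [evalL]
  exact LieHom.congr_fun h l

theorem evalV_comp {k : Type u} [Field k] {S T : Type} {H H' : Rep k} (a : H.L →ₗ⁅k⁆ H'.L)
    (b : H.V →ₗ[k] H'.V) (hab : ∀ l v, b (H.act l v) = H'.act (a l) (b v))
    (f : S → H.L) (g : T → H.V) (v : T →₀ FreeAlgebra k S) :
    evalV H' (fun s => a (f s)) (fun t => b (g t)) v = b (evalV H f g v) := by
  have key : ∀ (c : FreeAlgebra k S) (w : H.V),
      (FreeAlgebra.lift k (fun s => (H'.act (a (f s)) : Module.End k H'.V)) c) (b w) =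
        b ((FreeAlgebra.lift k (fun s => (H.act (f s) : Module.End k H.V)) c) w) := by
    intro c
    induction c using FreeAlgebra.induction with
    | grade0 r => intro w; simp
    | grade1 s => intro w; simp [hab]
    | mul c d hc hd => intro w; rw [map_mul, map_mul, Module.End.mul_apply, hd, hc]; rfl
    | add c d hc hd =>
      intro w
      rw [map_add, map_add, LinearMap.add_apply, hc, hd, LinearMap.add_apply, map_add]
  induction v using Finsupp.induction_linear with
  | zero => simp
  | add v w hv hw => rw [map_add, map_add, map_add, hv, hw]
  | single t c => rw [evalV_single, evalV_single, key]

end AbsolutelyFree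

/-- `H` satisfies the identities `p.1 = p.2` for all `p ∈ E₁` (identities of the first sort) and all
`p ∈ E₂` (identities of the second sort). An identity is a pair of elements of the same sort of the
absolutely free representation in countably many variables of each sort. -/
def Satisfies {k : Type u} [Field k]
    (E₁ : Set (FreeLieAlgebra k ℕ × FreeLieAlgebra k ℕ))
    (E₂ : Set ((ℕ →₀ FreeAlgebra k ℕ) × (ℕ →₀ FreeAlgebra k ℕ))) (H : Rep k) : Prop :=
  ∀ (f : ℕ → H.L) (g : ℕ → H.V),
    (∀ p ∈ E₁, evalL H f p.1 = evalL H f p.2) ∧ (∀ p ∈ E₂, evalV H f g p.1 = evalV H f g p.2)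

/-- A variety of representations: the class of all representations that satisfy some set of
identities. -/
structure Variety (k : Type u) [Field k] where
  carrier : Set (Rep k)
  equational : ∃ (E₁ : Set (FreeLieAlgebra k ℕ × FreeLieAlgebra k ℕ))
    (E₂ : Set ((ℕ →₀ FreeAlgebra k ℕ) × (ℕ →₀ FreeAlgebra k ℕ))),
    ∀ H : Rep k, H ∈ carrier ↔ Satisfies E₁ E₂ H

namespace Variety

variable {k : Type u} [Field k] (Θ : Variety k)

/-- The ideal `I_Θ(X₁)` of `L(X₁)`: all `l` such that the identity `l = 0` holds in `Θ`. -/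
def idealI (X₁ : Finset ℕ) : LieIdeal k (FreeLieAlgebra k X₁) where
  carrier := {l | ∀ H ∈ Θ.carrier, ∀ f : X₁ → H.L, evalL H f l = 0}
  add_mem' := fun {a b} ha hb H hH f => by rw [map_add, ha H hH f, hb H hH f, add_zero]
  zero_mem' := fun H _ f => by rw [map_zero]
  smul_mem' := fun c a ha H hH f => by rw [map_smul, ha H hH f, smul_zero]
  lie_mem := fun {x m} hm H hH f => by rw [LieHom.map_lie, hm H hH f, lie_zero]

/-- The submodule `V_Θ(X)` of `A(X₁) X₂`: all `v` such that the identity `v = 0` holds in `Θ`. -/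
def subV (X₁ X₂ : Finset ℕ) : Submodule k (X₂ →₀ FreeAlgebra k X₁) where
  carrier := {v | ∀ H ∈ Θ.carrier, ∀ (f : X₁ → H.L) (g : X₂ → H.V), evalV H f g v = 0}
  add_mem' := fun {a b} ha hb H hH f g => by rw [map_add, ha H hH f g, hb H hH f g, add_zero]
  zero_mem' := fun H _ f g => by rw [map_zero]
  smul_mem' := fun c a ha H hH f g => by rw [map_smul, ha H hH f g, smul_zero]

theorem mem_idealI {X₁ : Finset ℕ} {l : FreeLieAlgebra k X₁} :
    l ∈ Θ.idealI X₁ ↔ ∀ H ∈ Θ.carrier, ∀ f : X₁ → H.L, evalL H f l = 0 := Iff.rfl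

theorem mem_subV {X₁ X₂ : Finset ℕ} {v : X₂ →₀ FreeAlgebra k X₁} :
    v ∈ Θ.subV X₁ X₂ ↔
      ∀ H ∈ Θ.carrier, ∀ (f : X₁ → H.L) (g : X₂ → H.V), evalV H f g v = 0 := Iff.rfl

theorem act_mem_subV (X₁ X₂ : Finset ℕ) (l : FreeLieAlgebra k X₁) :
    Θ.subV X₁ X₂ ≤ (Θ.subV X₁ X₂).comap ((absFree k X₁ X₂).act l) := by
  intro v hv H hH f g
  exact (evalV_act H f g l v).trans (by rw [hv H hH f g, map_zero])

/-- The action of `L(X₁)` on `A(X₁) X₂ / V_Θ(X)`. -/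
noncomputable def actQ (X₁ X₂ : Finset ℕ) :
    FreeLieAlgebra k X₁ →ₗ[k]
      ((X₂ →₀ FreeAlgebra k X₁) ⧸ Θ.subV X₁ X₂) →ₗ[k] ((X₂ →₀ FreeAlgebra k X₁) ⧸ Θ.subV X₁ X₂) where
  toFun := fun l => (Θ.subV X₁ X₂).mapQ (Θ.subV X₁ X₂) ((absFree k X₁ X₂).act l)
    (Θ.act_mem_subV X₁ X₂ l)
  map_add' := fun x y => by
    apply Submodule.linearMap_qext
    refine LinearMap.ext fun v => ?_
    exact congrArg (Submodule.Quotient.mk (p := Θ.subV X₁ X₂))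
      (LinearMap.congr_fun ((absFree k X₁ X₂).act.map_add x y) v)
  map_smul' := fun c x => by
    apply Submodule.linearMap_qext
    refine LinearMap.ext fun v => ?_
    exact congrArg (Submodule.Quotient.mk (p := Θ.subV X₁ X₂))
      (LinearMap.congr_fun ((absFree k X₁ X₂).act.map_smul c x) v)

theorem actQ_eq_zero (X₁ X₂ : Finset ℕ) :
    (Θ.idealI X₁).toSubmodule ≤ LinearMap.ker (Θ.actQ X₁ X₂) := by
  intro l hl
  rw [LinearMap.mem_ker]
  apply Submodule.linearMap_qext
  refine LinearMap.ext fun v => ?_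
  refine (Submodule.Quotient.mk_eq_zero (Θ.subV X₁ X₂)).2 ?_
  intro H hH f g
  exact (evalV_act H f g l v).trans (by
    rw [(Θ.mem_idealI.1 hl) H hH f, map_zero, LinearMap.zero_apply])

/-- The free representation `F_Θ(X)` of the variety `Θ` generated by a finite set `X` with
`X₁` generators of the first sort and `X₂` of the second one; the symbols of each sort are numbered by
`ℕ`. It is the quotient `L(X₁) / I_Θ(X₁)`, `A(X₁) X₂ / V_Θ(X)` of the absolutely free
representation by the congruence of all the identities of `Θ` in the variables `X`. -/
noncomputable def free (X₁ X₂ : Finset ℕ) : Rep k where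
  L := FreeLieAlgebra k X₁ ⧸ Θ.idealI X₁
  V := (X₂ →₀ FreeAlgebra k X₁) ⧸ Θ.subV X₁ X₂
  act := (Θ.idealI X₁).toSubmodule.liftQ (Θ.actQ X₁ X₂) (Θ.actQ_eq_zero X₁ X₂)
  act_lie := fun x y v => by
    induction x using Submodule.Quotient.induction_on with | _ x
    induction y using Submodule.Quotient.induction_on with | _ y
    induction v using Submodule.Quotient.induction_on with | _ v
    exact congrArg (Submodule.Quotient.mk (p := Θ.subV X₁ X₂)) ((absFree k X₁ X₂).act_lie x y v)

/-- The generators of the first sort of `F_Θ(X)`. -/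
noncomputable def gen₁ {X₁ X₂ : Finset ℕ} (x : X₁) : (Θ.free X₁ X₂).L :=
  LieSubmodule.Quotient.mk (N := Θ.idealI X₁) (FreeLieAlgebra.of k x)

/-- The generators of the second sort of `F_Θ(X)`. -/
noncomputable def gen₂ {X₁ X₂ : Finset ℕ} (y : X₂) : (Θ.free X₁ X₂).V :=
  Submodule.Quotient.mk (p := Θ.subV X₁ X₂) (Finsupp.single y 1)

/-- The first-sort component of the homomorphism `α : F_Θ(X) → H`, for `H ∈ Θ`, that sends the
generators to the values of `f` (and of any `g` in the second sort). -/
noncomputable def liftL {H : Rep k} (hH : H ∈ Θ.carrier) {X₁ X₂ : Finset ℕ} (f : X₁ → H.L) :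
    (Θ.free X₁ X₂).L →ₗ[k] H.L :=
  (Θ.idealI X₁).toSubmodule.liftQ (evalL H f : FreeLieAlgebra k X₁ →ₗ[k] H.L)
    fun _ hl => LinearMap.mem_ker.2 (Θ.mem_idealI.1 hl H hH f)

/-- The second-sort component of the homomorphism `α : F_Θ(X) → H`, for `H ∈ Θ`, that sends the
generators to the values of `f` and `g`. -/
noncomputable def liftV {H : Rep k} (hH : H ∈ Θ.carrier) {X₁ X₂ : Finset ℕ} (f : X₁ → H.L)
    (g : X₂ → H.V) : (Θ.free X₁ X₂).V →ₗ[k] H.V :=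
  (Θ.subV X₁ X₂).liftQ (evalV H f g) fun _ hv => LinearMap.mem_ker.2 (Θ.mem_subV.1 hv H hH f g)

theorem liftL_gen₁ {H : Rep k} (hH : H ∈ Θ.carrier) {X₁ X₂ : Finset ℕ} (f : X₁ → H.L) (x : X₁) :
    Θ.liftL hH f (Θ.gen₁ x : (Θ.free X₁ X₂).L) = f x :=
  evalL_of H f x

theorem liftV_gen₂ {H : Rep k} (hH : H ∈ Θ.carrier) {X₁ X₂ : Finset ℕ} (f : X₁ → H.L)
    (g : X₂ → H.V) (y : X₂) : Θ.liftV hH f g (Θ.gen₂ y : (Θ.free X₁ X₂).V) = g y := by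
  refine (evalV_single H f g y 1).trans ?_
  simp

theorem liftL_lie {H : Rep k} (hH : H ∈ Θ.carrier) {X₁ X₂ : Finset ℕ} (f : X₁ → H.L)
    (x y : (Θ.free X₁ X₂).L) : Θ.liftL hH f ⁅x, y⁆ = ⁅Θ.liftL hH f x, Θ.liftL hH f y⁆ := by
  induction x using Submodule.Quotient.induction_on with | _ x
  induction y using Submodule.Quotient.induction_on with | _ y
  exact LieHom.map_lie (evalL H f) x y

theorem liftV_act {H : Rep k} (hH : H ∈ Θ.carrier) {X₁ X₂ : Finset ℕ} (f : X₁ → H.L)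
    (g : X₂ → H.V) (l : (Θ.free X₁ X₂).L) (v : (Θ.free X₁ X₂).V) :
    Θ.liftV hH f g ((Θ.free X₁ X₂).act l v) = H.act (Θ.liftL hH f l) (Θ.liftV hH f g v) := by
  induction l using Submodule.Quotient.induction_on with | _ l
  induction v using Submodule.Quotient.induction_on with | _ v
  exact evalV_act H f g l v

/-- `F_Θ(X)` belongs to `Θ`. -/
theorem free_mem (X₁ X₂ : Finset ℕ) : Θ.free X₁ X₂ ∈ Θ.carrier := by
  obtain ⟨E₁, E₂, hE⟩ := Θ.equational
  rw [hE]
  intro f g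
  let a : (absFree k X₁ X₂).L →ₗ⁅k⁆ (Θ.free X₁ X₂).L :=
    { (Θ.idealI X₁).toSubmodule.mkQ with map_lie' := fun {_ _} => rfl }
  let b : (absFree k X₁ X₂).V →ₗ[k] (Θ.free X₁ X₂).V := (Θ.subV X₁ X₂).mkQ
  have ha : Function.Surjective a := Submodule.Quotient.mk_surjective (Θ.idealI X₁).toSubmodule
  have hb : Function.Surjective b := Submodule.Quotient.mk_surjective (Θ.subV X₁ X₂)
  choose f' hf' using fun n => ha (f n)
  choose g' hg' using fun n => hb (g n)
  obtain rfl : (fun n => a (f' n)) = f := funext hf'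
  obtain rfl : (fun n => b (g' n)) = g := funext hg'
  constructor
  · intro p hp
    rw [evalL_comp a f', evalL_comp a f']
    refine (Submodule.Quotient.eq (Θ.idealI X₁).toSubmodule).2 ?_
    intro H hH φ
    refine (map_sub (evalL H φ) _ _).trans (sub_eq_zero.2 ?_)
    have h := (((hE H).1 hH) (fun n => evalL H φ (f' n)) (fun _ => 0)).1 p hp
    exact ((evalL_comp (H := absFree k X₁ X₂) (evalL H φ) f' p.1).symm.trans h).trans
      (evalL_comp (H := absFree k X₁ X₂) (evalL H φ) f' p.2)
  · intro p hp
    rw [evalV_comp a b (fun _ _ => rfl) f' g', evalV_comp a b (fun _ _ => rfl) f' g']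
    refine (Submodule.Quotient.eq (Θ.subV X₁ X₂)).2 ?_
    intro H hH φ ψ
    refine (map_sub (evalV H φ ψ) _ _).trans (sub_eq_zero.2 ?_)
    have h := (((hE H).1 hH) (fun n => evalL H φ (f' n)) (fun n => evalV H φ ψ (g' n))).2 p hp
    exact ((evalV_comp (H := absFree k X₁ X₂) (evalL H φ) (evalV H φ ψ)
        (fun l v => evalV_act H φ ψ l v) f' g' p.1).symm.trans h).trans
      (evalV_comp (H := absFree k X₁ X₂) (evalL H φ) (evalV H φ ψ)
        (fun l v => evalV_act H φ ψ l v) f' g' p.2)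

/-- `Θ` is an action-type variety: all the ideals `I_Θ(X₁)` are zero. -/
def IsActionType : Prop :=
  ∀ X₁ : Finset ℕ, Θ.idealI X₁ = ⊥

/-- `Θ` is degenerated: the identity `[x₁, x₂] ∘ y = 0` holds in `Θ`. -/
def IsDegenerated : Prop :=
  ∀ H ∈ Θ.carrier, ∀ (x₁ x₂ : H.L) (y : H.V), H.act ⁅x₁, x₂⁆ y = 0

end Variety

/-- The operations of the signature of representations on a pair of sets, without any laws. -/
structure Operations (k : Type u) (A₁ A₂ : Type u) where
  zero₁ : A₁
  neg₁ : A₁ → A₁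
  smul₁ : k → A₁ → A₁
  add₁ : A₁ → A₁ → A₁
  bracket : A₁ → A₁ → A₁
  zero₂ : A₂
  neg₂ : A₂ → A₂
  smul₂ : k → A₂ → A₂
  add₂ : A₂ → A₂ → A₂
  act : A₁ → A₂ → A₂

/-- The standard operations of a representation. -/
def Rep.operations {k : Type u} [Field k] (H : Rep k) : Operations k H.L H.V where
  zero₁ := 0
  neg₁ := fun x => -x
  smul₁ := fun c x => c • x
  add₁ := fun x y => x + y
  bracket := fun x y => ⁅x, y⁆
  zero₂ := 0
  neg₂ := fun v => -v
  smul₂ := fun c v => c • v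
  add₂ := fun v w => v + w
  act := fun x v => H.act x v

/-- A pair of maps (one for each sort) is a homomorphism of two-sorted algebras. -/
structure IsHom {k A₁ A₂ B₁ B₂ : Type u} (P : Operations k A₁ A₂) (Q : Operations k B₁ B₂)
    (s₁ : A₁ → B₁) (s₂ : A₂ → B₂) : Prop where
  zero₁ : s₁ P.zero₁ = Q.zero₁
  neg₁ : ∀ x, s₁ (P.neg₁ x) = Q.neg₁ (s₁ x)
  smul₁ : ∀ c x, s₁ (P.smul₁ c x) = Q.smul₁ c (s₁ x)
  add₁ : ∀ x y, s₁ (P.add₁ x y) = Q.add₁ (s₁ x) (s₁ y)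
  bracket : ∀ x y, s₁ (P.bracket x y) = Q.bracket (s₁ x) (s₁ y)
  zero₂ : s₂ P.zero₂ = Q.zero₂
  neg₂ : ∀ v, s₂ (P.neg₂ v) = Q.neg₂ (s₂ v)
  smul₂ : ∀ c v, s₂ (P.smul₂ c v) = Q.smul₂ c (s₂ v)
  add₂ : ∀ v w, s₂ (P.add₂ v w) = Q.add₂ (s₂ v) (s₂ w)
  act : ∀ x v, s₂ (P.act x v) = Q.act (s₁ x) (s₂ v)

/-- The variable number `0` of a one-element set of variables. -/
abbrev var : ({0} : Finset ℕ) := ⟨0, by simp⟩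

/-- The first of two variables. -/
abbrev var₁ : ({0, 1} : Finset ℕ) := ⟨0, by simp⟩

/-- The second of two variables. -/
abbrev var₂ : ({0, 1} : Finset ℕ) := ⟨1, by simp⟩

/-- The assignment of values to no variables. -/
def assign₀ {A : Type u} : (∅ : Finset ℕ) → A := fun i => absurd i.2 (Finset.notMem_empty i.1)

/-- The assignment of a value to one variable. -/
def assign₁ {A : Type u} (h : A) : ({0} : Finset ℕ) → A := fun _ => h

/-- The assignment of values to two variables. -/
def assign₂ {A : Type u} (h₁ h₂ : A) : ({0, 1} : Finset ℕ) → A :=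
  fun i => if i.1 = 0 then h₁ else h₂

/-- A system of words `W = {w_ω ∈ F_ω | ω ∈ Ω}`: one word for every operation `ω` of the signature,
in the free representation `F_ω` of `Θ` whose free generators are the arguments of `ω`; the word has
the sort of the result of `ω`. -/
structure WordSystem {k : Type u} [Field k] (Θ : Variety k) where
  zero₁ : (Θ.free ∅ ∅).L
  neg₁ : (Θ.free {0} ∅).L
  smul₁ : k → (Θ.free {0} ∅).L
  add₁ : (Θ.free {0, 1} ∅).L
  bracket : (Θ.free {0, 1} ∅).L
  zero₂ : (Θ.free ∅ ∅).V
  neg₂ : (Θ.free ∅ {0}).V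
  smul₂ : k → (Θ.free ∅ {0}).V
  add₂ : (Θ.free ∅ {0, 1}).V
  act : (Θ.free {0} {0}).V

namespace WordSystem

variable {k : Type u} [Field k] {Θ : Variety k}

/-- The algebra `H_W^*`: the verbal operations defined by the words of `W` on the carriers of a
representation `H ∈ Θ`. The verbal operation of a word `w` sends `h₁, …, hₙ` to `α(w)`, where
`α` is the homomorphism to `H` that sends the generators to `h₁, …, hₙ`. -/
noncomputable def operations (W : WordSystem Θ) {H : Rep k} (hH : H ∈ Θ.carrier) :
    Operations k H.L H.V where
  zero₁ := Θ.liftL hH assign₀ W.zero₁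
  neg₁ := fun x => Θ.liftL hH (assign₁ x) W.neg₁
  smul₁ := fun c x => Θ.liftL hH (assign₁ x) (W.smul₁ c)
  add₁ := fun x y => Θ.liftL hH (assign₂ x y) W.add₁
  bracket := fun x y => Θ.liftL hH (assign₂ x y) W.bracket
  zero₂ := Θ.liftV hH assign₀ assign₀ W.zero₂
  neg₂ := fun v => Θ.liftV hH assign₀ (assign₁ v) W.neg₂
  smul₂ := fun c v => Θ.liftV hH assign₀ (assign₁ v) (W.smul₂ c)
  add₂ := fun v w => Θ.liftV hH assign₀ (assign₂ v w) W.add₂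
  act := fun x v => Θ.liftV hH (assign₁ x) (assign₁ v) W.act

/-- The condition on a system of words `W`: for every finite `X` there is a sort-preserving bijection
`s` of `F = F_Θ(X)` onto itself that fixes the free generators and is an isomorphism from `F` to
`F_W^*`. -/
def IsVerbal (W : WordSystem Θ) : Prop :=
  ∀ X₁ X₂ : Finset ℕ,
    ∃ (s₁ : (Θ.free X₁ X₂).L ≃ (Θ.free X₁ X₂).L) (s₂ : (Θ.free X₁ X₂).V ≃ (Θ.free X₁ X₂).V),
      (∀ x : X₁, s₁ (Θ.gen₁ x) = Θ.gen₁ x) ∧ (∀ y : X₂, s₂ (Θ.gen₂ y) = Θ.gen₂ y) ∧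
      IsHom (Θ.free X₁ X₂).operations (W.operations (Θ.free_mem X₁ X₂)) s₁ s₂

end WordSystem

end LieRepresentation

open LieRepresentation

/-! Since `s` fixes the generators, and since the endomorphism of `F_ω` fixing the generators is the
identity, every word is recovered as `w_ω = s(ω(generators))`. The laws of a representation,
transported by `s`, therefore become equations between words, and these are solved by homogeneity.

The one-generated Lie algebra is a line, so scalars act through some `φ : k → k`, which is
multiplicative and surjective because `s` is. Scaling both summands by a preimage of 2 under `φ`
shows that the word of the sum is multiplied by 2 when its variables are doubled. In characteristic
0 only degree 1 has this weight, so the word is linear. The laws `x + 0 = x = 0 + x` make both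
coefficients 1, and `φ` becomes an automorphism. It then fixes 2 and 3, and scaling the variables by
2 and 3 leaves the bracket only the weight 6, that is bidegree `(1, 1)`: a multiple `a[x₁, x₂]`. In
the same way the action word is `b(x ∘ y)`. All this takes place in relatively free objects: scaling
the generators defines endomorphisms there, and the independence of their eigenspaces replaces a
direct-sum grading.

On the second sort, words without Lie variables are automatically linear. Non-degeneracy gives `x ∘
y ≠ 0`, hence `b ≠ 0` by injectivity of `s`. Comparing `c(x ∘ y)` with `(cx) ∘ y` forces the same
`φ` on both sorts. Applying `s` to the law for `[x₁, x₂] ∘ y` gives `ab = b²`, because `[x₁, x₂] ∘ y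
≠ 0`, so `a = b`. -/

namespace LieRepresentation

/-! ### Eigenvectors in a space spanned by eigenvectors -/

/-- If the submodules `S i` consist of eigenvectors of `D` with eigenvalues `μ i` and span everything,
then an eigenvector with eigenvalue `c` lies in the span of the `S i` with `μ i = c`. -/
theorem mem_iSup_of_eigenvector {k M ι : Type*} [Field k] [AddCommGroup M] [Module k M]
    (D : Module.End k M) (S : ι → Submodule k M) (μ : ι → k)
    (hS : ∀ i, ∀ v ∈ S i, D v = μ i • v) (htop : ⨆ i, S i = ⊤) {c : k} {v : M}
    (hv : D v = c • v) : v ∈ ⨆ (i) (_ : μ i = c), S i := by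
  -- Pieces with eigenvalue `c` are kept; all others go into the remaining eigenspaces. The `S i`
  -- need not be independent, because the eigenspaces of `D` are.
  have hle : (⊤ : Submodule k M) ≤
      (⨆ (i) (_ : μ i = c), S i) ⊔ ⨆ (d) (_ : d ≠ c), D.eigenspace d := by
    rw [← htop]
    refine iSup_le fun i => ?_
    by_cases h : μ i = c
    · exact le_sup_of_le_left (le_iSup₂_of_le i h le_rfl)
    · exact le_sup_of_le_right (le_iSup₂_of_le (μ i) h
        fun w hw => Module.End.mem_eigenspace_iff.2 (hS i w hw))
  obtain ⟨t, ht, w, hw, rfl⟩ := Submodule.mem_sup.1 (hle (Submodule.mem_top (x := v)))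
  have ht' : t ∈ D.eigenspace c := by
    have : (⨆ (i) (_ : μ i = c), S i) ≤ D.eigenspace c :=
      iSup₂_le fun i hi x hx => Module.End.mem_eigenspace_iff.2 (by rw [hS i x hx, hi])
    exact this ht
  have hw' : w ∈ D.eigenspace c := by
    have := Submodule.sub_mem _ (Module.End.mem_eigenspace_iff.2 hv) ht'
    rwa [add_sub_cancel_left] at this
  have hw0 : w = 0 := Submodule.disjoint_def.1 (Module.End.eigenspaces_iSupIndep D c) w hw' hw
  rwa [hw0, add_zero]

namespace Variety

variable {k : Type u} [Field k] (Θ : Variety k)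

/-! ### Generation of the free representations, and the small cases -/

/-- The first sort of `F_Θ(X)` is generated by `X₁` as a Lie algebra. -/
theorem free_L_eq_top {X₁ X₂ : Finset ℕ} (N : Submodule k (Θ.free X₁ X₂).L)
    (hgen : ∀ x, Θ.gen₁ x ∈ N) (hlie : ∀ x ∈ N, ∀ y ∈ N, ⁅x, y⁆ ∈ N) : N = ⊤ := by
  let N' : LieSubalgebra k (Θ.free X₁ X₂).L :=
    { N with lie_mem' := fun {x y} hx hy => hlie x hx y hy }
  let e : FreeLieAlgebra k X₁ →ₗ⁅k⁆ N' := FreeLieAlgebra.lift k fun x => ⟨Θ.gen₁ x, hgen x⟩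
  let m : FreeLieAlgebra k X₁ →ₗ⁅k⁆ (Θ.free X₁ X₂).L :=
    { (Θ.idealI X₁).toSubmodule.mkQ with map_lie' := fun {_ _} => rfl }
  -- The quotient map factors through `N'`, since both sides agree on free generators; being onto,
  -- it forces `N'` to be everything.
  have h : N'.incl.comp e = m := by
    apply FreeLieAlgebra.hom_ext
    intro x
    simp only [LieHom.comp_apply, e, FreeLieAlgebra.lift_of_apply]
    rfl
  refine eq_top_iff.2 fun l _ => ?_
  obtain ⟨l, rfl⟩ := Submodule.Quotient.mk_surjective (Θ.idealI X₁).toSubmodule l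
  have := LieHom.congr_fun h l
  change (Submodule.Quotient.mk l : (Θ.free X₁ X₂).L) ∈ N'
  exact (show _ = (Submodule.Quotient.mk l : (Θ.free X₁ X₂).L) from this) ▸ (e l).2

/-- The second sort of `F_Θ(X)` is generated by `X₂` under the action of the elements of `X₁`. -/
theorem free_V_eq_top {X₁ X₂ : Finset ℕ} (N : Submodule k (Θ.free X₁ X₂).V)
    (hgen : ∀ y, Θ.gen₂ y ∈ N)
    (hact : ∀ x, ∀ v ∈ N, (Θ.free X₁ X₂).act (Θ.gen₁ x) v ∈ N) : N = ⊤ := by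
  -- Stability under the generators `X₁` propagates to the whole free associative algebra.
  have key : ∀ (a : FreeAlgebra k X₁) (v : X₂ →₀ FreeAlgebra k X₁),
      v ∈ N.comap (Θ.subV X₁ X₂).mkQ → a • v ∈ N.comap (Θ.subV X₁ X₂).mkQ := by
    intro a
    induction a using FreeAlgebra.induction with
    | grade0 r =>
      intro v hv
      rw [algebraMap_smul]
      exact Submodule.smul_mem _ r hv
    | grade1 x =>
      intro v hv
      rw [← iota_of]
      exact hact x _ hv
    | mul a b ha hb =>
      intro v hv
      rw [mul_smul]
      exact ha _ (hb _ hv)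
    | add a b ha hb =>
      intro v hv
      rw [add_smul]
      exact Submodule.add_mem _ (ha _ hv) (hb _ hv)
  refine eq_top_iff.2 fun v _ => ?_
  obtain ⟨v, rfl⟩ := Submodule.Quotient.mk_surjective (Θ.subV X₁ X₂) v
  change v ∈ N.comap (Θ.subV X₁ X₂).mkQ
  induction v using Finsupp.induction_linear with
  | zero => exact Submodule.zero_mem _
  | add v w hv hw => exact Submodule.add_mem _ (hv trivial) (hw trivial)
  | single y a =>
    have := key a (Finsupp.single y 1) (hgen y)
    rwa [Finsupp.smul_single, smul_eq_mul, mul_one] at this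

/-- The endomorphism of `F_Θ(X)` that fixes the generators is the identity on the first sort. -/
theorem liftL_free_gen₁ {X₁ X₂ : Finset ℕ} (l : (Θ.free X₁ X₂).L) :
    Θ.liftL (Θ.free_mem X₁ X₂) (X₂ := X₂) Θ.gen₁ l = l := by
  have h := Θ.free_L_eq_top
    (LinearMap.eqLocus (Θ.liftL (Θ.free_mem X₁ X₂) (X₂ := X₂) Θ.gen₁) LinearMap.id)
    (fun x => Θ.liftL_gen₁ _ _ x) (fun x hx y hy => by
      rw [LinearMap.mem_eqLocus] at *
      rw [liftL_lie, hx, hy]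
      rfl)
  exact LinearMap.mem_eqLocus.1 (h ▸ Submodule.mem_top (x := l))

/-- The endomorphism of `F_Θ(X)` that fixes the generators is the identity on the second sort. -/
theorem liftV_free_gen₂ {X₁ X₂ : Finset ℕ} (v : (Θ.free X₁ X₂).V) :
    Θ.liftV (Θ.free_mem X₁ X₂) Θ.gen₁ Θ.gen₂ v = v := by
  have h := Θ.free_V_eq_top
    (LinearMap.eqLocus (Θ.liftV (Θ.free_mem X₁ X₂) Θ.gen₁ Θ.gen₂) LinearMap.id)
    (fun y => Θ.liftV_gen₂ _ _ _ y) (fun x v hv => by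
      rw [LinearMap.mem_eqLocus] at *
      rw [liftV_act, hv, liftL_free_gen₁]
      rfl)
  exact LinearMap.mem_eqLocus.1 (h ▸ Submodule.mem_top (x := v))

theorem free_L_subsingleton (X₂ : Finset ℕ) : Subsingleton (Θ.free ∅ X₂).L := by
  have h := Θ.free_L_eq_top (X₁ := ∅) (X₂ := X₂) ⊥
    (fun x => absurd x.2 (Finset.notMem_empty x.1)) (fun x hx y _ => by
      rw [Submodule.mem_bot] at *
      rw [hx, zero_lie])
  exact (Submodule.subsingleton_iff k).1 (subsingleton_of_bot_eq_top h)

theorem free_V_subsingleton (X₁ : Finset ℕ) : Subsingleton (Θ.free X₁ ∅).V := by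
  have h := Θ.free_V_eq_top (X₁ := X₁) (X₂ := ∅) ⊥
    (fun x => absurd x.2 (Finset.notMem_empty x.1)) (fun x v hv => by
      rw [Submodule.mem_bot] at *
      rw [hv, map_zero])
  exact (Submodule.subsingleton_iff k).1 (subsingleton_of_bot_eq_top h)

/-- Since `[x, x] = 0`, the line through the generator is already a subalgebra. -/
theorem exists_smul_gen₁ (X₂ : Finset ℕ) (l : (Θ.free {0} X₂).L) :
    ∃ c : k, l = c • Θ.gen₁ var := by
  have h := Θ.free_L_eq_top (X₁ := {0}) (X₂ := X₂) (Submodule.span k {Θ.gen₁ var})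
    (fun x => by
      obtain rfl : x = var := Subsingleton.elim _ _
      exact Submodule.mem_span_singleton_self _) (fun x hx y hy => by
      obtain ⟨a, rfl⟩ := Submodule.mem_span_singleton.1 hx
      obtain ⟨b, rfl⟩ := Submodule.mem_span_singleton.1 hy
      rw [smul_lie, lie_smul, lie_self, smul_zero, smul_zero]
      exact Submodule.zero_mem _)
  obtain ⟨c, hc⟩ := Submodule.mem_span_singleton.1 (h ▸ Submodule.mem_top (x := l))
  exact ⟨c, hc.symm⟩

theorem exists_smul_gen₂ (v : (Θ.free ∅ {0}).V) : ∃ c : k, v = c • Θ.gen₂ var := by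
  have h := Θ.free_V_eq_top (X₁ := ∅) (X₂ := {0}) (Submodule.span k {Θ.gen₂ var})
    (fun x => by
      obtain rfl : x = var := Subsingleton.elim _ _
      exact Submodule.mem_span_singleton_self _)
    (fun x => absurd x.2 (Finset.notMem_empty x.1))
  obtain ⟨c, hc⟩ := Submodule.mem_span_singleton.1 (h ▸ Submodule.mem_top (x := v))
  exact ⟨c, hc.symm⟩

theorem eq_var₁_or_eq_var₂ (x : ({0, 1} : Finset ℕ)) : x = var₁ ∨ x = var₂ := by
  obtain ⟨x, hx⟩ := x
  simpa [Subtype.ext_iff] using hx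

/-- Without first-sort generators nothing acts, so linear combinations exhaust the second sort. -/
theorem exists_smul_gen₂_add (v : (Θ.free ∅ {0, 1}).V) :
    ∃ c d : k, v = c • Θ.gen₂ var₁ + d • Θ.gen₂ var₂ := by
  have h := Θ.free_V_eq_top (X₁ := ∅) (X₂ := {0, 1})
    (Submodule.span k {Θ.gen₂ var₁, Θ.gen₂ var₂})
    (fun x => by
      rcases eq_var₁_or_eq_var₂ x with rfl | rfl
      · exact Submodule.subset_span (Set.mem_insert _ _)
      · exact Submodule.subset_span (Set.mem_insert_of_mem _ rfl))
    (fun x => absurd x.2 (Finset.notMem_empty x.1))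
  obtain ⟨c, d, hc⟩ := Submodule.mem_span_pair.1 (h ▸ Submodule.mem_top (x := v))
  exact ⟨c, d, hc.symm⟩

/-! ### Bidegrees in the Lie algebra on two generators -/

/-- The element `[x₁, x₂]` of `F_Θ(X)`, where `X₁ = {x₁, x₂}`. -/
noncomputable abbrev lieGen (X₂ : Finset ℕ) : (Θ.free {0, 1} X₂).L :=
  ⁅(Θ.gen₁ var₁ : (Θ.free {0, 1} X₂).L), (Θ.gen₁ var₂ : (Θ.free {0, 1} X₂).L)⁆

/-- The endomorphism of `L(x₁, x₂) / I_Θ` that multiplies `x₁` by `c` and `x₂` by `d`. -/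
noncomputable def scaleL (c d : k) : Module.End k (Θ.free {0, 1} ∅).L :=
  Θ.liftL (Θ.free_mem {0, 1} ∅) (assign₂ (c • Θ.gen₁ var₁) (d • Θ.gen₁ var₂))

theorem scaleL_gen₁_var₁ (c d : k) : Θ.scaleL c d (Θ.gen₁ var₁) = c • Θ.gen₁ var₁ :=
  Θ.liftL_gen₁ _ _ _

theorem scaleL_gen₁_var₂ (c d : k) : Θ.scaleL c d (Θ.gen₁ var₂) = d • Θ.gen₁ var₂ :=
  Θ.liftL_gen₁ _ _ _

theorem scaleL_lie (c d : k) (x y : (Θ.free {0, 1} ∅).L) :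
    Θ.scaleL c d ⁅x, y⁆ = ⁅Θ.scaleL c d x, Θ.scaleL c d y⁆ :=
  Θ.liftL_lie _ _ _ _

/-- Elements of bidegree `(i, j)`: those multiplied by `c ^ i * d ^ j` whenever the generators are
multiplied by `c` and `d`. -/
def bihomogeneous (i j : ℕ) : Submodule k (Θ.free {0, 1} ∅).L where
  carrier := {l | ∀ c d : k, Θ.scaleL c d l = (c ^ i * d ^ j) • l}
  add_mem' := fun {x y} hx hy c d => by rw [map_add, hx c d, hy c d, smul_add]
  zero_mem' := fun c d => by rw [map_zero, smul_zero]
  smul_mem' := fun r x hx c d => by rw [map_smul, hx c d, smul_comm]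

theorem lie_mem_bihomogeneous {i j i' j' : ℕ} {x y : (Θ.free {0, 1} ∅).L}
    (hx : x ∈ Θ.bihomogeneous i j) (hy : y ∈ Θ.bihomogeneous i' j') :
    ⁅x, y⁆ ∈ Θ.bihomogeneous (i + i') (j + j') := fun c d => by
  rw [scaleL_lie, hx c d, hy c d, smul_lie, lie_smul, smul_smul]
  congr 1
  ring

/-- The component of bidegree `m`, given by its spanning set for the bidegrees at most `(1, 1)`. -/
noncomputable def component (m : ℕ × ℕ) : Submodule k (Θ.free {0, 1} ∅).L :=
  if m = (0, 0) then ⊥ else if m = (1, 0) then Submodule.span k {Θ.gen₁ var₁}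
  else if m = (0, 1) then Submodule.span k {Θ.gen₁ var₂}
  else if m = (1, 1) then Submodule.span k {Θ.lieGen ∅} else Θ.bihomogeneous m.1 m.2

theorem component_zero_zero : Θ.component (0, 0) = ⊥ := if_pos rfl

theorem component_one_zero : Θ.component (1, 0) = Submodule.span k {Θ.gen₁ var₁} := by
  simp [component]

theorem component_zero_one : Θ.component (0, 1) = Submodule.span k {Θ.gen₁ var₂} := by
  simp [component]

theorem component_one_one : Θ.component (1, 1) = Submodule.span k {Θ.lieGen ∅} := by
  simp [component]

theorem component_of_ne {m : ℕ × ℕ} (h₀₀ : m ≠ (0, 0)) (h₁₀ : m ≠ (1, 0)) (h₀₁ : m ≠ (0, 1))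
    (h₁₁ : m ≠ (1, 1)) : Θ.component m = Θ.bihomogeneous m.1 m.2 := by
  rw [component, if_neg h₀₀, if_neg h₁₀, if_neg h₀₁, if_neg h₁₁]

theorem component_le (m : ℕ × ℕ) : Θ.component m ≤ Θ.bihomogeneous m.1 m.2 := by
  have h₁ : Θ.gen₁ var₁ ∈ Θ.bihomogeneous 1 0 := fun c d => by
    rw [scaleL_gen₁_var₁, pow_one, pow_zero, mul_one]
  have h₂ : Θ.gen₁ var₂ ∈ Θ.bihomogeneous 0 1 := fun c d => by
    rw [scaleL_gen₁_var₂, pow_one, pow_zero, one_mul]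
  have h₃ : Θ.lieGen ∅ ∈ Θ.bihomogeneous 1 1 := fun c d => by
    rw [lieGen, scaleL_lie, scaleL_gen₁_var₁, scaleL_gen₁_var₂, smul_lie, lie_smul, smul_smul,
      pow_one, pow_one]
  by_cases h₀₀ : m = (0, 0)
  · rw [h₀₀, component_zero_zero]
    exact bot_le
  by_cases h₁₀ : m = (1, 0)
  · rw [h₁₀, component_one_zero]
    exact (Submodule.span_singleton_le_iff_mem _ _).2 h₁
  by_cases h₀₁ : m = (0, 1)
  · rw [h₀₁, component_zero_one]
    exact (Submodule.span_singleton_le_iff_mem _ _).2 h₂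
  by_cases h₁₁ : m = (1, 1)
  · rw [h₁₁, component_one_one]
    exact (Submodule.span_singleton_le_iff_mem _ _).2 h₃
  exact (Θ.component_of_ne h₀₀ h₁₀ h₀₁ h₁₁).le

/-- Two nonzero bidegrees never add up to `(0, 0)`, `(1, 0)` or `(0, 1)`, and they give `(1, 1)`
only as `(1, 0) + (0, 1)` in some order. So the explicit spans need a check in that case alone, and
elsewhere bihomogeneity suffices. -/
theorem lie_mem_component {m n : ℕ × ℕ} {x y : (Θ.free {0, 1} ∅).L}
    (hx : x ∈ Θ.component m) (hy : y ∈ Θ.component n) : ⁅x, y⁆ ∈ Θ.component (m + n) := by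
  have h := Θ.lie_mem_bihomogeneous (Θ.component_le m hx) (Θ.component_le n hy)
  have hz : ∀ l : (Θ.free {0, 1} ∅).L, l ∈ Θ.component (0, 0) → l = 0 :=
    fun l hl => (Submodule.mem_bot k).1 (Θ.component_zero_zero ▸ hl)
  by_cases hm : m = (0, 0)
  · subst hm
    rw [hz x hx, zero_lie]
    exact Submodule.zero_mem _
  by_cases hn : n = (0, 0)
  · subst hn
    rw [hz y hy, lie_zero]
    exact Submodule.zero_mem _
  obtain ⟨i, j⟩ := m
  obtain ⟨i', j'⟩ := n
  by_cases h11 : (i, j) + (i', j') = (1, 1)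
  · rw [h11, component_one_one]
    have : (i = 1 ∧ j = 0 ∧ i' = 0 ∧ j' = 1) ∨ (i = 0 ∧ j = 1 ∧ i' = 1 ∧ j' = 0) := by
      simp only [Prod.mk_add_mk, Prod.mk.injEq] at h11 hm hn
      omega
    rcases this with ⟨rfl, rfl, rfl, rfl⟩ | ⟨rfl, rfl, rfl, rfl⟩
    · rw [component_one_zero] at hx
      rw [component_zero_one] at hy
      obtain ⟨a, rfl⟩ := Submodule.mem_span_singleton.1 hx
      obtain ⟨b, rfl⟩ := Submodule.mem_span_singleton.1 hy
      rw [smul_lie, lie_smul]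
      exact Submodule.smul_mem _ _ (Submodule.smul_mem _ _ (Submodule.mem_span_singleton_self _))
    · rw [component_zero_one] at hx
      rw [component_one_zero] at hy
      obtain ⟨a, rfl⟩ := Submodule.mem_span_singleton.1 hx
      obtain ⟨b, rfl⟩ := Submodule.mem_span_singleton.1 hy
      rw [smul_lie, lie_smul, ← lie_skew]
      exact Submodule.smul_mem _ _ (Submodule.smul_mem _ _
        (Submodule.neg_mem _ (Submodule.mem_span_singleton_self _)))
  · rw [component_of_ne]
    · exact h
    all_goals
      simp only [Prod.mk_add_mk, ne_eq, Prod.mk.injEq] at h11 hm hn ⊢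
      omega

/-- The span of the components contains the generators and is closed under the bracket. Directness
of the sum is never needed. -/
theorem iSup_component : ⨆ m, Θ.component m = ⊤ := by
  refine Θ.free_L_eq_top _ (fun x => ?_) fun x hx y hy => ?_
  · rcases eq_var₁_or_eq_var₂ x with rfl | rfl
    · exact Submodule.mem_iSup_of_mem (1, 0) (Θ.component_one_zero ▸ Submodule.mem_span_singleton_self _)
    · exact Submodule.mem_iSup_of_mem (0, 1) (Θ.component_zero_one ▸ Submodule.mem_span_singleton_self _)
  · induction hx using Submodule.iSup_induction' with
    | zero => rw [zero_lie]; exact Submodule.zero_mem _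
    | add x x' _ _ hx hx' => rw [add_lie]; exact Submodule.add_mem _ hx hx'
    | mem m x hx =>
      induction hy using Submodule.iSup_induction' with
      | zero => rw [lie_zero]; exact Submodule.zero_mem _
      | add y y' _ _ hy hy' => rw [lie_add]; exact Submodule.add_mem _ hy hy'
      | mem n y hy => exact Submodule.mem_iSup_of_mem (m + n) (Θ.lie_mem_component hx hy)

/-- An element of `L(x₁, x₂) / I_Θ` that is homogeneous of degree one is linear. -/
theorem exists_eq_add_of_scaleL [CharZero k] {l : (Θ.free {0, 1} ∅).L}
    (hl : Θ.scaleL 2 2 l = (2 : k) • l) : ∃ c d : k, l = c • Θ.gen₁ var₁ + d • Θ.gen₁ var₂ := by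
  have h := mem_iSup_of_eigenvector (Θ.scaleL 2 2) Θ.component (fun m => 2 ^ m.1 * 2 ^ m.2)
    (fun m v hv => Θ.component_le m hv 2 2) Θ.iSup_component hl
  have hle : (⨆ (m : ℕ × ℕ) (_ : (2 : k) ^ m.1 * 2 ^ m.2 = 2), Θ.component m) ≤
      Submodule.span k {Θ.gen₁ var₁, Θ.gen₁ var₂} := by
    refine iSup₂_le fun m hm => ?_
    obtain ⟨i, j⟩ := m
    -- Characteristic 0 turns the equation of weights in `k` into one between natural numbers.
    have hij : i + j = 1 := by
      have : (2 : ℕ) ^ (i + j) = 2 ^ 1 := by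
        rw [← pow_add] at hm
        exact_mod_cast hm.trans (pow_one _).symm
      exact Nat.pow_right_injective le_rfl this
    obtain ⟨rfl, rfl⟩ | ⟨rfl, rfl⟩ : (i = 1 ∧ j = 0) ∨ (i = 0 ∧ j = 1) := by omega
    · rw [component_one_zero]
      exact Submodule.span_mono (Set.singleton_subset_iff.2 (Set.mem_insert _ _))
    · rw [component_zero_one]
      exact Submodule.span_mono (Set.singleton_subset_iff.2 (Set.mem_insert_of_mem _ rfl))
  obtain ⟨c, d, hc⟩ := Submodule.mem_span_pair.1 (hle h)
  exact ⟨c, d, hc.symm⟩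

/-- An element of `L(x₁, x₂) / I_Θ` of bidegree `(1, 1)` is a multiple of `[x₁, x₂]`. -/
theorem exists_eq_smul_lie_of_scaleL [CharZero k] {l : (Θ.free {0, 1} ∅).L}
    (hl : Θ.scaleL 2 3 l = (6 : k) • l) : ∃ c : k, l = c • Θ.lieGen ∅ := by
  have h := mem_iSup_of_eigenvector (Θ.scaleL 2 3) Θ.component (fun m => 2 ^ m.1 * 3 ^ m.2)
    (fun m v hv => Θ.component_le m hv 2 3) Θ.iSup_component hl
  -- Different primes isolate `(1, 1)`; scaling both variables by 2 would give `(2, 0)` and `(0, 2)`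
  -- the same weight 4.
  have hle : (⨆ (m : ℕ × ℕ) (_ : (2 : k) ^ m.1 * 3 ^ m.2 = 6), Θ.component m) ≤
      Submodule.span k {Θ.lieGen ∅} := by
    refine iSup₂_le fun m hm => ?_
    obtain ⟨i, j⟩ := m
    have hm' : 2 ^ i * 3 ^ j = 6 := by
      simp only at hm
      exact_mod_cast hm
    obtain ⟨rfl, rfl⟩ : i = 1 ∧ j = 1 := by
      have hi : i < 3 := by
        by_contra! hi
        have := Nat.le_of_dvd (by norm_num) (hm' ▸ Dvd.intro _ rfl : 2 ^ i ∣ 6)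
        have := Nat.pow_le_pow_right (n := 2) (by norm_num) hi
        omega
      have hj : j < 2 := by
        by_contra! hj
        have := Nat.le_of_dvd (by norm_num) (hm' ▸ Dvd.intro_left _ rfl : 3 ^ j ∣ 6)
        have := Nat.pow_le_pow_right (n := 3) (by norm_num) hj
        omega
      interval_cases i <;> interval_cases j <;> simp_all
    exact Θ.component_one_one.le
  obtain ⟨c, hc⟩ := Submodule.mem_span_singleton.1 (hle h)
  exact ⟨c, hc.symm⟩

/-! ### Degree in `x` in the module on one generator of each sort -/

/-- The endomorphism of the second sort of `F_Θ(x, y)` that multiplies `x` by `c`. -/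
noncomputable def scaleV (c : k) : Module.End k (Θ.free {0} {0}).V :=
  Θ.liftV (Θ.free_mem {0} {0}) (assign₁ (c • Θ.gen₁ var)) (assign₁ (Θ.gen₂ var))

theorem scaleV_pow (c : k) (i : ℕ) :
    Θ.scaleV c (((Θ.free {0} {0}).act (Θ.gen₁ var))^[i] (Θ.gen₂ var)) =
      c ^ i • ((Θ.free {0} {0}).act (Θ.gen₁ var))^[i] (Θ.gen₂ var) := by
  induction i with
  | zero =>
    rw [pow_zero, one_smul]
    exact Θ.liftV_gen₂ _ _ _ _
  | succ i ih =>
    rw [Function.iterate_succ_apply']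
    refine (Θ.liftV_act _ _ _ _ _).trans ?_
    rw [liftL_gen₁]
    refine (congrArg _ ih).trans ?_
    rw [assign₁, map_smul, map_smul, LinearMap.smul_apply, smul_smul, pow_succ]

/-- An element of the second sort of `F_Θ(x, y)` of degree one in `x` is a multiple of `x ∘ y`. -/
theorem exists_eq_smul_act_of_scaleV [CharZero k] {v : (Θ.free {0} {0}).V}
    (hv : Θ.scaleV 2 v = (2 : k) • v) :
    ∃ c : k, v = c • (Θ.free {0} {0}).act (Θ.gen₁ var) (Θ.gen₂ var) := by
  let p : ℕ → (Θ.free {0} {0}).V := fun i =>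
    ((Θ.free {0} {0}).act (Θ.gen₁ var))^[i] (Θ.gen₂ var)
  have htop : ⨆ i, Submodule.span k {p i} = ⊤ := by
    refine Θ.free_V_eq_top _ (fun y => ?_) fun x v hv => ?_
    · obtain rfl : y = var := Subsingleton.elim _ _
      exact Submodule.mem_iSup_of_mem 0 (Submodule.mem_span_singleton_self _)
    · obtain rfl : x = var := Subsingleton.elim _ _
      induction hv using Submodule.iSup_induction' with
      | zero => rw [map_zero]; exact Submodule.zero_mem _
      | add v w _ _ hv hw => rw [map_add]; exact Submodule.add_mem _ hv hw
      | mem i v hv =>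
        obtain ⟨c, rfl⟩ := Submodule.mem_span_singleton.1 hv
        rw [map_smul]
        refine Submodule.smul_mem _ _ (Submodule.mem_iSup_of_mem (i + 1)
          (Submodule.mem_span_singleton.2 ⟨1, ?_⟩))
        rw [one_smul]
        exact Function.iterate_succ_apply' _ _ _
  have h := mem_iSup_of_eigenvector (Θ.scaleV 2) (fun i => Submodule.span k {p i})
    (fun i => 2 ^ i) (fun i v hv => by
      obtain ⟨c, rfl⟩ := Submodule.mem_span_singleton.1 hv
      rw [map_smul, scaleV_pow, smul_comm]) htop hv
  have hle : (⨆ (i : ℕ) (_ : (2 : k) ^ i = 2), Submodule.span k {p i}) ≤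
      Submodule.span k {p 1} := by
    refine iSup₂_le fun i hi => ?_
    obtain rfl : i = 1 := by
      have : (2 : ℕ) ^ i = 2 ^ 1 := by exact_mod_cast hi.trans (pow_one _).symm
      exact Nat.pow_right_injective le_rfl this
    exact le_rfl
  obtain ⟨c, hc⟩ := Submodule.mem_span_singleton.1 (hle h)
  exact ⟨c, hc.symm⟩

/-! ### Nonvanishing from non-degeneracy -/

variable {Θ}

theorem act_lieGen_ne_zero (h : ¬ Θ.IsDegenerated) :
    (Θ.free {0, 1} {0}).act (Θ.lieGen {0}) (Θ.gen₂ var) ≠ 0 := by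
  intro h0
  refine h fun H hH x₁ x₂ y => ?_
  have := congrArg (Θ.liftV hH (assign₂ x₁ x₂) (assign₁ y)) h0
  rw [map_zero, liftV_act, liftL_lie, liftL_gen₁, liftL_gen₁, liftV_gen₂] at this
  exact this

/-- The identity `x ∘ y = 0` would specialize, at `x = [x₁, x₂]`, to degeneracy. -/
theorem act_gen_ne_zero (h : ¬ Θ.IsDegenerated) :
    (Θ.free {0} {0}).act (Θ.gen₁ var) (Θ.gen₂ var) ≠ 0 := by
  intro h0
  refine h fun H hH x₁ x₂ y => ?_
  have := congrArg (Θ.liftV hH (assign₁ ⁅x₁, x₂⁆) (assign₁ y)) h0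
  rw [map_zero, liftV_act, liftL_gen₁, liftV_gen₂] at this
  exact this

/-- A vanishing generator could be sent to any `[x₁, x₂]`, making all brackets zero. -/
theorem gen₁_ne_zero (h : ¬ Θ.IsDegenerated) {X₁ X₂ : Finset ℕ} (x : X₁) :
    (Θ.gen₁ x : (Θ.free X₁ X₂).L) ≠ 0 := by
  intro h0
  refine h fun H hH x₁ x₂ y => ?_
  have := congrArg (Θ.liftL hH (fun _ => ⁅x₁, x₂⁆)) h0
  rw [map_zero, liftL_gen₁] at this
  rw [this, map_zero, LinearMap.zero_apply]

theorem gen₂_ne_zero (h : ¬ Θ.IsDegenerated) {X₁ X₂ : Finset ℕ} (y : X₂) :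
    (Θ.gen₂ y : (Θ.free X₁ X₂).V) ≠ 0 := by
  intro h0
  refine h fun H hH x₁ x₂ z => ?_
  have := congrArg (Θ.liftV hH 0 (fun _ => z)) h0
  rw [map_zero, liftV_gen₂] at this
  rw [this, map_zero]

end Variety

/-! ### Evaluation of words at their own variables -/

section Assign

variable {k : Type u} [Field k] (Θ : Variety k) (X : Finset ℕ)

theorem assign₁_gen₁ : assign₁ (Θ.gen₁ var : (Θ.free {0} X).L) = Θ.gen₁ :=
  funext fun x => congrArg Θ.gen₁ (Subsingleton.elim var x)

theorem assign₁_gen₂ : assign₁ (Θ.gen₂ var : (Θ.free X {0}).V) = Θ.gen₂ :=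
  funext fun x => congrArg Θ.gen₂ (Subsingleton.elim var x)

theorem assign₂_gen₁ :
    assign₂ (Θ.gen₁ var₁ : (Θ.free {0, 1} X).L) (Θ.gen₁ var₂) = Θ.gen₁ :=
  funext fun x => by rcases Variety.eq_var₁_or_eq_var₂ x with rfl | rfl <;> rfl

theorem assign₀_gen₁ : (assign₀ : _ → (Θ.free ∅ X).L) = Θ.gen₁ :=
  funext fun x => absurd x.2 (Finset.notMem_empty x.1)

end Assign

/-! ### Verbal operations of words of known form -/

namespace WordSystem

variable {k : Type u} [Field k] {Θ : Variety k} {W : WordSystem Θ}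

section Operations

variable {H : Rep k} (hH : H ∈ Θ.carrier)

theorem operations_zero₁ : (W.operations hH).zero₁ = 0 := by
  have := Θ.free_L_subsingleton ∅
  change Θ.liftL hH _ W.zero₁ = 0
  rw [Subsingleton.elim W.zero₁ 0, map_zero]

theorem operations_zero₂ : (W.operations hH).zero₂ = 0 := by
  have := Θ.free_V_subsingleton ∅
  change Θ.liftV hH _ _ W.zero₂ = 0
  rw [Subsingleton.elim W.zero₂ 0, map_zero]

theorem operations_smul₁ {c d : k} (h : W.smul₁ c = d • Θ.gen₁ var) (x : H.L) :
    (W.operations hH).smul₁ c x = d • x := by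
  change Θ.liftL hH _ (W.smul₁ c) = _
  rw [h, map_smul, Variety.liftL_gen₁]
  rfl

theorem operations_smul₂ {c d : k} (h : W.smul₂ c = d • Θ.gen₂ var) (v : H.V) :
    (W.operations hH).smul₂ c v = d • v := by
  change Θ.liftV hH _ _ (W.smul₂ c) = _
  rw [h, map_smul, Variety.liftV_gen₂]
  rfl

theorem operations_add₁ {c d : k} (h : W.add₁ = c • Θ.gen₁ var₁ + d • Θ.gen₁ var₂) (x y : H.L) :
    (W.operations hH).add₁ x y = c • x + d • y := by
  change Θ.liftL hH _ W.add₁ = _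
  rw [h, map_add, map_smul, map_smul, Variety.liftL_gen₁, Variety.liftL_gen₁]
  rfl

theorem operations_add₂ {c d : k} (h : W.add₂ = c • Θ.gen₂ var₁ + d • Θ.gen₂ var₂) (v w : H.V) :
    (W.operations hH).add₂ v w = c • v + d • w := by
  change Θ.liftV hH _ _ W.add₂ = _
  rw [h, map_add, map_smul, map_smul, Variety.liftV_gen₂, Variety.liftV_gen₂]
  rfl

theorem operations_bracket {a : k} (h : W.bracket = a • Θ.lieGen ∅) (x y : H.L) :
    (W.operations hH).bracket x y = a • ⁅x, y⁆ := by
  change Θ.liftL hH _ W.bracket = _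
  rw [h, map_smul, Variety.liftL_lie, Variety.liftL_gen₁, Variety.liftL_gen₁]
  rfl

theorem operations_act {b : k}
    (h : W.act = b • (Θ.free {0} {0}).act (Θ.gen₁ var) (Θ.gen₂ var)) (x : H.L) (v : H.V) :
    (W.operations hH).act x v = b • H.act x v := by
  change Θ.liftV hH _ _ W.act = _
  rw [h, map_smul, Variety.liftV_act, Variety.liftL_gen₁, Variety.liftV_gen₂]
  rfl

end Operations

theorem map_zero₁ {H : Rep k} {hH : H ∈ Θ.carrier} {s₁ : H.L → H.L} {s₂ : H.V → H.V}
    (hs : IsHom H.operations (W.operations hH) s₁ s₂) : s₁ 0 = 0 :=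
  hs.zero₁.trans (operations_zero₁ hH)

theorem map_zero₂ {H : Rep k} {hH : H ∈ Θ.carrier} {s₁ : H.L → H.L} {s₂ : H.V → H.V}
    (hs : IsHom H.operations (W.operations hH) s₁ s₂) : s₂ 0 = 0 :=
  hs.zero₂.trans (operations_zero₂ hH)

/-! ### Words of the first sort -/

/-- The words of the scalar multiplications on the first sort are given by a surjective
multiplicative map `k → k`. -/
theorem exists_smul₁_eq (hnd : ¬ Θ.IsDegenerated) (hW : W.IsVerbal) :
    ∃ φ : k → k, (∀ c, W.smul₁ c = φ c • Θ.gen₁ var) ∧ Function.Surjective φ ∧ φ 1 = 1 ∧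
      ∀ c d, φ (c * d) = φ c * φ d := by
  choose φ hφ using fun c => Θ.exists_smul_gen₁ ∅ (W.smul₁ c)
  obtain ⟨s₁, s₂, hs₁, -, hs⟩ := hW {0} ∅
  have hx := Variety.gen₁_ne_zero hnd (X₂ := ∅) var
  have hsmul : ∀ c v, s₁ (c • v) = φ c • s₁ v :=
    fun c v => (hs.smul₁ c v).trans (operations_smul₁ _ (hφ c) _)
  have hinj : ∀ {c d : k}, c • (Θ.gen₁ var : (Θ.free {0} ∅).L) = d • Θ.gen₁ var → c = d :=
    fun h => smul_left_injective k hx h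
  refine ⟨φ, hφ, fun c => ?_, hinj ?_, fun c d => hinj ?_⟩
  -- A preimage of `c x` under `s₁` is some `d x`, whence `φ d = c`.
  · obtain ⟨v, hv⟩ := s₁.surjective (c • Θ.gen₁ var)
    obtain ⟨d, rfl⟩ := Θ.exists_smul_gen₁ ∅ v
    rw [hsmul, hs₁] at hv
    exact ⟨d, hinj hv⟩
  · rw [← hs₁, ← hsmul, one_smul, one_smul]
  · rw [mul_smul, ← hs₁, ← hsmul, ← hsmul, ← hsmul, mul_smul]

/-- Homogeneity of degree one makes the word linear; the neutrality of zero on either side fixes its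
coefficients. -/
theorem add₁_eq [CharZero k] (hnd : ¬ Θ.IsDegenerated) (hW : W.IsVerbal) :
    W.add₁ = Θ.gen₁ var₁ + Θ.gen₁ var₂ := by
  obtain ⟨φ, hφ, hsurj, -, -⟩ := exists_smul₁_eq hnd hW
  obtain ⟨s₁, s₂, hs₁, -, hs⟩ := hW {0, 1} ∅
  have hsmul : ∀ c v, s₁ (c • v) = φ c • s₁ v :=
    fun c v => (hs.smul₁ c v).trans (operations_smul₁ _ (hφ c) _)
  have hw : s₁ (Θ.gen₁ var₁ + Θ.gen₁ var₂) = W.add₁ := (hs.add₁ _ _).trans (by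
    rw [hs₁, hs₁]
    change Θ.liftL _ (assign₂ _ _) _ = _
    rw [assign₂_gen₁, Variety.liftL_free_gen₁])
  -- Additivity of `φ` rests on this lemma, so `φ 2 = 2` is not yet available; surjectivity supplies
  -- a scalar with image 2 instead.
  obtain ⟨t, ht⟩ := hsurj 2
  have hscale : Θ.scaleL 2 2 W.add₁ = (2 : k) • W.add₁ := by
    have h := hs.add₁ (t • Θ.gen₁ var₁) (t • Θ.gen₁ var₂)
    rw [hsmul, hsmul, hs₁, hs₁, ht] at h
    refine h.symm.trans ?_
    change s₁ (_ + _) = _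
    rw [← smul_add, hsmul, ht, hw]
  obtain ⟨c, d, hcd⟩ := Θ.exists_eq_add_of_scaleL hscale
  have hadd : ∀ x y, s₁ (x + y) = c • s₁ x + d • s₁ y :=
    fun x y => (hs.add₁ x y).trans (operations_add₁ _ hcd _ _)
  have hc : c = 1 := by
    have h := hadd (Θ.gen₁ var₁) 0
    rw [map_zero₁ hs, smul_zero, add_zero, add_zero, hs₁] at h
    exact smul_left_injective k (Variety.gen₁_ne_zero hnd var₁) (h.symm.trans (one_smul k _).symm)
  have hd : d = 1 := by
    have h := hadd 0 (Θ.gen₁ var₁)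
    rw [map_zero₁ hs, smul_zero, zero_add, zero_add, hs₁] at h
    exact smul_left_injective k (Variety.gen₁_ne_zero hnd var₁) (h.symm.trans (one_smul k _).symm)
  rw [hcd, hc, hd, one_smul, one_smul]

/-- The words of the scalar multiplications on the first sort are given by an automorphism of `k`. -/
theorem exists_ringEquiv_smul₁_eq [CharZero k] (hnd : ¬ Θ.IsDegenerated) (hW : W.IsVerbal) :
    ∃ φ : k ≃+* k, ∀ c, W.smul₁ c = φ c • Θ.gen₁ var := by
  have hadd₁ := add₁_eq hnd hW
  obtain ⟨φ, hφ, hsurj, hone, hmul⟩ := exists_smul₁_eq hnd hW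
  obtain ⟨s₁, s₂, hs₁, -, hs⟩ := hW {0} ∅
  have hx := Variety.gen₁_ne_zero hnd (X₂ := ∅) var
  have hsmul : ∀ c v, s₁ (c • v) = φ c • s₁ v :=
    fun c v => (hs.smul₁ c v).trans (operations_smul₁ _ (hφ c) _)
  have hinj : ∀ {c d : k}, c • (Θ.gen₁ var : (Θ.free {0} ∅).L) = d • Θ.gen₁ var → c = d :=
    fun h => smul_left_injective k hx h
  have hadd : ∀ c d, φ (c + d) = φ c + φ d := fun c d => hinj (by
    rw [← hs₁, ← hsmul, add_smul, add_smul, ← hsmul, ← hsmul]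
    refine (hs.add₁ _ _).trans ((operations_add₁ _ (c := 1) (d := 1) ?_ _ _).trans ?_)
    · rw [one_smul, one_smul, hadd₁]
    · rw [one_smul, one_smul])
  have hzero : φ 0 = 0 := by
    have h := hadd 0 0
    rwa [add_zero, left_eq_add] at h
  let f : k →+* k :=
    { toFun := φ, map_one' := hone, map_mul' := hmul, map_zero' := hzero, map_add' := hadd }
  exact ⟨RingEquiv.ofBijective f ⟨f.injective, hsurj⟩, hφ⟩

/-- As a ring automorphism `φ` fixes 2 and 3, so scaling the arguments by them multiplies the word
by 6. -/
theorem exists_bracket_eq [CharZero k] (hnd : ¬ Θ.IsDegenerated) (hW : W.IsVerbal) :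
    ∃ a : k, W.bracket = a • Θ.lieGen ∅ := by
  obtain ⟨φ, hφ⟩ := exists_ringEquiv_smul₁_eq hnd hW
  obtain ⟨s₁, s₂, hs₁, -, hs⟩ := hW {0, 1} ∅
  have hsmul : ∀ c v, s₁ (c • v) = φ c • s₁ v :=
    fun c v => (hs.smul₁ c v).trans (operations_smul₁ _ (hφ c) _)
  have hw : s₁ (Θ.lieGen ∅) = W.bracket := (hs.bracket _ _).trans (by
    rw [hs₁, hs₁]
    change Θ.liftL _ (assign₂ _ _) _ = _
    rw [assign₂_gen₁, Variety.liftL_free_gen₁])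
  have hscale : Θ.scaleL 2 3 W.bracket = (6 : k) • W.bracket := by
    have h := hs.bracket ((2 : k) • Θ.gen₁ var₁) ((3 : k) • Θ.gen₁ var₂)
    rw [hsmul, hsmul, hs₁, hs₁, map_ofNat, map_ofNat] at h
    refine h.symm.trans ?_
    change s₁ ⁅_, _⁆ = _
    rw [smul_lie, lie_smul, hsmul, hsmul, map_ofNat, map_ofNat, hw, smul_smul]
    norm_num
  exact Θ.exists_eq_smul_lie_of_scaleL hscale

/-! ### Words of the second sort -/

theorem add₂_eq (hnd : ¬ Θ.IsDegenerated) (hW : W.IsVerbal) :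
    W.add₂ = Θ.gen₂ var₁ + Θ.gen₂ var₂ := by
  obtain ⟨s₁, s₂, -, hs₂, hs⟩ := hW ∅ {0}
  obtain ⟨c, d, hcd⟩ := Θ.exists_smul_gen₂_add W.add₂
  have hadd : ∀ x y, s₂ (x + y) = c • s₂ x + d • s₂ y :=
    fun x y => (hs.add₂ x y).trans (operations_add₂ _ hcd _ _)
  have hc : c = 1 := by
    have h := hadd (Θ.gen₂ var) 0
    rw [map_zero₂ hs, smul_zero, add_zero, add_zero, hs₂] at h
    exact smul_left_injective k (Variety.gen₂_ne_zero hnd var) (h.symm.trans (one_smul k _).symm)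
  have hd : d = 1 := by
    have h := hadd 0 (Θ.gen₂ var)
    rw [map_zero₂ hs, smul_zero, zero_add, zero_add, hs₂] at h
    exact smul_left_injective k (Variety.gen₂_ne_zero hnd var) (h.symm.trans (one_smul k _).symm)
  rw [hcd, hc, hd, one_smul, one_smul]

theorem exists_act_eq [CharZero k] (hnd : ¬ Θ.IsDegenerated) (hW : W.IsVerbal) :
    ∃ b : k, b ≠ 0 ∧ W.act = b • (Θ.free {0} {0}).act (Θ.gen₁ var) (Θ.gen₂ var) := by
  obtain ⟨φ, hφ⟩ := exists_ringEquiv_smul₁_eq hnd hW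
  have hadd₂ := add₂_eq hnd hW
  obtain ⟨s₁, s₂, hs₁, hs₂, hs⟩ := hW {0} {0}
  have hw : s₂ ((Θ.free {0} {0}).act (Θ.gen₁ var) (Θ.gen₂ var)) = W.act :=
    (hs.act _ _).trans (by
      rw [hs₁, hs₂]
      change Θ.liftV _ (assign₁ _) (assign₁ _) _ = _
      rw [assign₁_gen₁, assign₁_gen₂, Variety.liftV_free_gen₂])
  have hscale : Θ.scaleV 2 W.act = (2 : k) • W.act := by
    have h := hs.act ((2 : k) • Θ.gen₁ var) (Θ.gen₂ var)
    have h' : s₁ ((2 : k) • Θ.gen₁ var) = (2 : k) • Θ.gen₁ var :=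
      (hs.smul₁ _ _).trans ((operations_smul₁ _ (hφ 2) _).trans (by rw [map_ofNat, hs₁]))
    rw [h', hs₂] at h
    refine h.symm.trans ?_
    change s₂ ((Θ.free {0} {0}).act _ _) = _
    -- The scalar words of the second sort are still unknown, so doubling is expressed through the
    -- sum, whose word is known.
    rw [map_smul, LinearMap.smul_apply, two_smul, two_smul, ← hw]
    refine (hs.add₂ _ _).trans ((operations_add₂ _ (c := 1) (d := 1) ?_ _ _).trans ?_)
    · rw [one_smul, one_smul, hadd₂]
    · rw [one_smul]
  obtain ⟨b, hb⟩ := Θ.exists_eq_smul_act_of_scaleV hscale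
  refine ⟨b, ?_, hb⟩
  -- With `b = 0` the injective `s₂` would send both `x ∘ y` and 0 to 0.
  rintro rfl
  refine Variety.act_gen_ne_zero hnd (s₂.injective ?_)
  rw [hw, hb, zero_smul, map_zero₂ hs]

/-- The words of the scalar multiplications on the second sort are given by the same map as those on
the first sort. -/
theorem smul₂_eq [CharZero k] (hnd : ¬ Θ.IsDegenerated) (hW : W.IsVerbal) {c d : k}
    (hc : W.smul₁ c = d • Θ.gen₁ var) : W.smul₂ c = d • Θ.gen₂ var := by
  obtain ⟨b, hb0, hb⟩ := exists_act_eq hnd hW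
  obtain ⟨e, he⟩ := Θ.exists_smul_gen₂ (W.smul₂ c)
  obtain ⟨s₁, s₂, hs₁, hs₂, hs⟩ := hW {0} {0}
  have hact : ∀ x v, s₂ ((Θ.free {0} {0}).act x v) = b • (Θ.free {0} {0}).act (s₁ x) (s₂ v) :=
    fun x v => (hs.act x v).trans (operations_act _ hb _ _)
  have h₁ : s₁ (c • Θ.gen₁ var) = d • Θ.gen₁ var :=
    (hs.smul₁ _ _).trans ((operations_smul₁ _ hc _).trans (by rw [hs₁]))
  have h₂ : s₂ (c • (Θ.free {0} {0}).act (Θ.gen₁ var) (Θ.gen₂ var)) =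
      e • s₂ ((Θ.free {0} {0}).act (Θ.gen₁ var) (Θ.gen₂ var)) :=
    (hs.smul₂ _ _).trans (operations_smul₂ _ he _)
  -- Computing `s₂((c x) ∘ y)` in two ways gives `eb = bd` as coefficients of the nonzero `x ∘ y`.
  have h := hact (c • Θ.gen₁ var) (Θ.gen₂ var)
  rw [map_smul, LinearMap.smul_apply, h₂, hact, h₁, hs₁, hs₂, map_smul, LinearMap.smul_apply,
    smul_comm e b] at h
  have h' := smul_left_injective k (Variety.act_gen_ne_zero hnd) (smul_right_injective _ hb0 h)
  rw [he]
  exact congrArg (· • _) h'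

/-! ### Negation, and equality of the coefficients of bracket and action -/

theorem neg₁_eq {d : k} (hW : W.IsVerbal) (hd : W.smul₁ (-1) = d • Θ.gen₁ var) :
    W.neg₁ = d • Θ.gen₁ var := by
  obtain ⟨s₁, s₂, hs₁, -, hs⟩ := hW {0} ∅
  have hw : s₁ (-Θ.gen₁ var) = W.neg₁ := (hs.neg₁ _).trans (by
    rw [hs₁]
    change Θ.liftL _ (assign₁ _) _ = _
    rw [assign₁_gen₁, Variety.liftL_free_gen₁])
  rw [← hw, ← neg_one_smul k]
  exact (hs.smul₁ _ _).trans ((operations_smul₁ _ hd _).trans (by rw [hs₁]))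

theorem neg₂_eq {d : k} (hW : W.IsVerbal) (hd : W.smul₂ (-1) = d • Θ.gen₂ var) :
    W.neg₂ = d • Θ.gen₂ var := by
  obtain ⟨s₁, s₂, -, hs₂, hs⟩ := hW ∅ {0}
  have hw : s₂ (-Θ.gen₂ var) = W.neg₂ := (hs.neg₂ _).trans (by
    rw [hs₂]
    change Θ.liftV _ _ (assign₁ _) _ = _
    rw [assign₀_gen₁, assign₁_gen₂, Variety.liftV_free_gen₂])
  rw [← hw, ← neg_one_smul k]
  exact (hs.smul₂ _ _).trans ((operations_smul₂ _ hd _).trans (by rw [hs₂]))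

/-- The coefficients of the words of the bracket and of the action agree. -/
theorem bracket_coeff_eq_act_coeff (hnd : ¬ Θ.IsDegenerated) (hW : W.IsVerbal) {a b : k}
    (hb0 : b ≠ 0) (ha : W.bracket = a • Θ.lieGen ∅)
    (hb : W.act = b • (Θ.free {0} {0}).act (Θ.gen₁ var) (Θ.gen₂ var)) : a = b := by
  have hadd₂ := add₂_eq hnd hW
  obtain ⟨s₁, s₂, hs₁, hs₂, hs⟩ := hW {0, 1} {0}
  have hact : ∀ x v,
      s₂ ((Θ.free {0, 1} {0}).act x v) = b • (Θ.free {0, 1} {0}).act (s₁ x) (s₂ v) :=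
    fun x v => (hs.act x v).trans (operations_act _ hb _ _)
  have hlie : ∀ x y, s₁ ⁅x, y⁆ = a • ⁅s₁ x, s₁ y⁆ :=
    fun x y => (hs.bracket x y).trans (operations_bracket _ ha _ _)
  have hadd : ∀ v w, s₂ (v + w) = s₂ v + s₂ w := fun v w =>
    (hs.add₂ v w).trans ((operations_add₂ _ (c := 1) (d := 1)
      (by rw [one_smul, one_smul, hadd₂]) _ _).trans (by rw [one_smul, one_smul]))
  have hsub : ∀ v w, s₂ (v - w) = s₂ v - s₂ w := fun v w =>
    eq_sub_of_add_eq (by rw [← hadd, sub_add_cancel])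
  -- The image of `[x₁, x₂] ∘ y` carries the coefficient `ba`; expanding the action law first gives
  -- `b²`, as each nested action contributes two factors.
  have h := hact (Θ.lieGen {0}) (Θ.gen₂ var)
  have h' := congrArg s₂ ((Θ.free {0, 1} {0}).act_lie (Θ.gen₁ var₁) (Θ.gen₁ var₂) (Θ.gen₂ var))
  rw [h, hsub, hact, hact, hact, hact, hlie, hs₁, hs₁, hs₂] at h'
  simp only [map_smul, LinearMap.smul_apply] at h'
  rw [← smul_sub, ← smul_sub, ← Rep.act_lie] at h'
  exact smul_left_injective k (Variety.act_lieGen_ne_zero hnd) (smul_right_injective _ hb0 h')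

end WordSystem

end LieRepresentation

open LieRepresentation
theorem mainTheorem4 {k : Type u} [Field k] [CharZero k] (Θ : Variety k)
    (hact : Θ.IsActionType) (hnd : ¬ Θ.IsDegenerated)
    (W : WordSystem Θ) (hW : W.IsVerbal) :
    ∃ (φ : k ≃+* k) (a : kˣ),
      W.zero₁ = 0 ∧
      W.neg₁ = -Θ.gen₁ var ∧
      (∀ c : k, W.smul₁ c = φ c • Θ.gen₁ var) ∧
      W.add₁ = Θ.gen₁ var₁ + Θ.gen₁ var₂ ∧
      W.bracket = (a : k) •
        ⁅(Θ.gen₁ var₁ : (Θ.free {0, 1} ∅).L), (Θ.gen₁ var₂ : (Θ.free {0, 1} ∅).L)⁆ ∧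
      W.zero₂ = 0 ∧
      W.neg₂ = -Θ.gen₂ var ∧
      (∀ c : k, W.smul₂ c = φ c • Θ.gen₂ var) ∧
      W.add₂ = Θ.gen₂ var₁ + Θ.gen₂ var₂ ∧
      W.act = (a : k) • (Θ.free {0} {0}).act (Θ.gen₁ var) (Θ.gen₂ var) := by
  obtain ⟨φ, hφ⟩ := WordSystem.exists_ringEquiv_smul₁_eq hnd hW
  obtain ⟨a, ha⟩ := WordSystem.exists_bracket_eq hnd hW
  obtain ⟨b, hb0, hb⟩ := WordSystem.exists_act_eq hnd hW
  obtain rfl := WordSystem.bracket_coeff_eq_act_coeff hnd hW hb0 ha hb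
  have hφ₂ : ∀ c, W.smul₂ c = φ c • Θ.gen₂ var := fun c => WordSystem.smul₂_eq hnd hW (hφ c)
  refine ⟨φ, Units.mk0 a hb0, (Θ.free_L_subsingleton ∅).elim _ _, ?_, hφ,
    WordSystem.add₁_eq hnd hW, ha, (Θ.free_V_subsingleton ∅).elim _ _, ?_, hφ₂,
    WordSystem.add₂_eq hnd hW, hb⟩
  · rw [WordSystem.neg₁_eq hW (hφ (-1)), map_neg, map_one, neg_one_smul]
  · rw [WordSystem.neg₂_eq hW (hφ₂ (-1)), map_neg, map_one, neg_one_smul]
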